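/- Setting. Let $(\Omega,\mathcal F,P)$ be a probability space, $\mathcal G\subset\mathcal F$ a sub-$\sigma$-field, $\mathbb T\subset\mathbb R$ with $\sup\mathbb T=\infty$, and let $\Theta\subset\mathbb R^{p}$ and $\mathcal T\subset\mathbb R^{q}$ be measurable sets, $\theta^*\in\Theta$. For each $T\in\mathbb T$ let $\mathbb H_T:\Omega\times\Theta\times\mathcal T\to\mathbb R$ be a random field that is continuous in $(\theta,\tau)\in\Theta\times\mathcal T$ for every $\omega$, let $\hat\tau_T$ be a $\mathcal T$-valued random variable, and let $\hat\theta_T$ be a $\Theta$-valued random variable that asymptotically maximizes $\mathbb H_T(\cdot,\hat\tau_T)$ on $\Theta$, that is, $P\big[\mathbb H_T(\hat\theta_T,\hat\tau_T)=\sup_{\theta\in\Theta}\mathbb H_T(\theta,\hat\tau_T)\big]\to1$ as $T\to\infty$. Let $a_T\in GL(p)$ be deterministic with $\|a_T\|=\{\mathrm{Tr}(a_Ta_T')\}^{1/2}\to0$ as $T\to\infty$. Put $$U_T=\{u\in\mathbb R^{p}:\theta^*+a_Tu\in\Theta\},\qquad \mathbb Z_T(u,\tau)=\exp\big(\mathbb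 H_T(\theta^*+a_Tu,\tau)-\mathbb H_T(\theta^*,\tau)\big)\quad(u\in U_T,\ \tau\in\mathcal T),$$ $$U=\bigcap_{\delta>0}\bigcup_{N=1}^\infty\bigcap_{T\in\mathbb T,\,T\ge N}U_T^{\delta},\qquad \hat u_T=a_T^{-1}(\hat\theta_T-\theta^*),$$ where $A^\delta=\{x\in\mathbb R^{p}:\inf_{a\in A}|x-a|<\delta\}$ and $A(R)=A\cap\{x:|x|\le R\}$ for $A\subset\mathbb R^{p}$. Let $\mathbb V_T$ $(T\in\mathbb T)$ and $\mathbb Z$ be random variables with values in $C(\mathbb R^{p})$, equipped with the topology of uniform convergence on compact sets. For random variables $Y_T$, $Y$ with values in a topological space $S$, $Y_T$ converges stably to $Y$ with respect to $\mathcal G$, written $Y_T\to^{d_s(\mathcal G)}Y$, if $E[f(Y_T)W]\to E[f(Y)W]$ as $T\to\infty$ for every bounded continuous $f:S\to\mathbb R$ and every bounded $\mathcal G$-measurable random variable $W$. Consider the following conditions. - [A1] $\displaystyle\limsup_{R\to\infty}\limsup_{T\to\infty}P\Big[\sup_{(u,\tau)\in U_T\times\mathcal T,\ |u|\ge R}\mathbb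 Z_T(u,\tau)\ge1\Big]=0$. - [A2] For every $R>0$, as $T\to\infty$, $\displaystyle\sup_{(u,\tau)\in U_T(R)\times\mathcal T}|\mathbb Z_T(u,\tau)-\mathbb V_T(u)|\to0$ in probability, and the restrictions to $\overline{B_R}=\{x\in\mathbb R^p:|x|\le R\}$ satisfy $\mathbb V_T|_{\overline{B_R}}\to^{d_s(\mathcal G)}\mathbb Z|_{\overline{B_R}}$ in $C(\overline{B_R})$. - [A3] $\displaystyle U\supset\bigcap_{N=1}^\infty\overline{\bigcup_{T\in\mathbb T,\,T\ge N}U_T}$. - [A4] $\hat u$ is a $U$-valued random variable such that, with probability $1$, $\mathbb Z(\hat u)=\sup_{u\in U}\mathbb Z(u)$ and $\mathbb Z(u)<\mathbb Z(\hat u)$ for all $u\in U$ with $u\ne\hat u$. - [A5] $T_0\in\mathbb T$ and $\hat v_T$ $(T\in\mathbb T,\ T\ge T_0)$ are $U$-valued random variables such that, for each such $T$, $\mathbb V_T(\hat v_T)=\sup_{u\in U}\mathbb V_T(u)$ with probability $1$, and the family $\{\hat v_T\}_{T\ge T_0}$ is tight. Theorem. Under [A1]–[A4], $\hat u_T\to^{d_s(\mathcal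 G)}\hat u$ as $T\to\infty$. If moreover [A5] holds, then $\hat u_T-\hat v_T=o_P(1)$ as $T\to\infty$. -/

import Mathlib

open MeasureTheory Filter Topology
open scoped ENNReal BoundedContinuousFunction

noncomputable section

/-- Euclidean space of dimension `n`. -/
abbrev Vec (n : ℕ) : Type := EuclideanSpace ℝ (Fin n)

/-- The action of an invertible matrix on vectors. -/
def glAct {p : ℕ} (A : Matrix.GeneralLinearGroup (Fin p) ℝ) (u : Vec p) : Vec p :=
  Matrix.toEuclideanLin (A : Matrix (Fin p) (Fin p) ℝ) u

/-- The norm `(Tr (A A'))^(1/2)` of a real matrix. -/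
def traceNorm {p : ℕ} (A : Matrix (Fin p) (Fin p) ℝ) : ℝ :=
  Real.sqrt (Matrix.trace (A * A.transpose))

/-- `Y_i` converges stably to `Y∞` with respect to the sub-σ-field `𝒢`, along the filter `l`:
`E[f(Y_i) W] → E[f(Y∞) W]` for all bounded continuous `f` and all bounded `𝒢`-measurable `W`. -/
def StablyConverges {Ω : Type*} (𝒢 : MeasurableSpace Ω) [MeasurableSpace Ω] (P : Measure Ω)
    {ι : Type*} (l : Filter ι) {S : Type*} [TopologicalSpace S]
    (Y : ι → Ω → S) (Ylim : Ω → S) : Prop :=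
  ∀ (f : S →ᵇ ℝ) (W : Ω → ℝ), Measurable[𝒢] W → (∃ C : ℝ, ∀ ω, |W ω| ≤ C) →
    Tendsto (fun i => ∫ ω, f (Y i ω) * W ω ∂P) l (𝓝 (∫ ω, f (Ylim ω) * W ω ∂P))

/-- A random variable with values in `C(ℝ^p)`, with the Borel σ-field of the topology of uniform
convergence on compact sets. -/
def IsRandomFunction {Ω : Type*} [MeasurableSpace Ω] {p : ℕ} (V : Ω → C(Vec p, ℝ)) : Prop :=
  Measurable[_, borel C(Vec p, ℝ)] V

/-- `V_T → Z` stably in `C(closedBall 0 R)` for every `R > 0`. -/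
def CondA2Stable {Ω : Type*} (𝒢 : MeasurableSpace Ω) [MeasurableSpace Ω] (P : Measure Ω)
    {𝕋 : Set ℝ} {p : ℕ} (V : 𝕋 → Ω → C(Vec p, ℝ)) (Z : Ω → C(Vec p, ℝ)) : Prop :=
  ∀ R : ℝ, 0 < R → StablyConverges 𝒢 P (atTop : Filter 𝕋)
    (fun T ω => (V T ω).restrict (Metric.closedBall (0 : Vec p) R))
    (fun ω => (Z ω).restrict (Metric.closedBall (0 : Vec p) R))

/-- `h` restricted to `Ω × Θ × 𝒯` is a continuous random field. Values of `h` outside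
`Θ × 𝒯` are irrelevant. -/
def IsContinuousRandomField {Ω : Type*} [MeasurableSpace Ω] {p q : ℕ}
    (Θ : Set (Vec p)) (𝒯 : Set (Vec q)) (h : Ω → Vec p → Vec q → ℝ) : Prop :=
  (∀ θ ∈ Θ, ∀ τ ∈ 𝒯, Measurable fun ω => h ω θ τ) ∧
    ∀ ω, ContinuousOn (fun ξ : Vec p × Vec q => h ω ξ.1 ξ.2) (Θ ×ˢ 𝒯)

/-- A random variable with values in the set `A`. -/
def IsRandomElementOf {Ω : Type*} [MeasurableSpace Ω] {n : ℕ} (A : Set (Vec n))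
    (X : Ω → Vec n) : Prop :=
  Measurable X ∧ ∀ ω, X ω ∈ A

section Local

variable {𝕋 : Set ℝ} {p q : ℕ}

/-- The local parameter set `U_T = {u | θ* + a_T u ∈ Θ}`. -/
def localSet (Θ : Set (Vec p)) (θs : Vec p) (a : 𝕋 → Matrix.GeneralLinearGroup (Fin p) ℝ)
    (T : 𝕋) : Set (Vec p) :=
  {u | θs + glAct (a T) u ∈ Θ}

/-- The set `U = ⋂_{δ > 0} ⋃_{N ≥ 1} ⋂_{T ≥ N} (U_T)^δ`. -/
def limitSet (Θ : Set (Vec p)) (θs : Vec p) (a : 𝕋 → Matrix.GeneralLinearGroup (Fin p) ℝ) :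
    Set (Vec p) :=
  ⋂ (δ : ℝ) (_ : 0 < δ), ⋃ (N : ℕ) (_ : 1 ≤ N), ⋂ (T : 𝕋) (_ : (N : ℝ) ≤ T),
    Metric.thickening δ (localSet Θ θs a T)

/-- The random field `Z_T(u, τ) = exp (H_T(θ* + a_T u, τ) - H_T(θ*, τ))`. -/
def localField {Ω : Type*} (H : 𝕋 → Ω → Vec p → Vec q → ℝ) (θs : Vec p)
    (a : 𝕋 → Matrix.GeneralLinearGroup (Fin p) ℝ) (T : 𝕋) (ω : Ω) (u : Vec p) (τ : Vec q) : ℝ :=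
  Real.exp (H T ω (θs + glAct (a T) u) τ - H T ω θs τ)

/-- The rescaled estimator `a_T⁻¹ (θ̂_T - θ*)`. -/
def rescaled {Ω : Type*} (θhat : 𝕋 → Ω → Vec p) (θs : Vec p)
    (a : 𝕋 → Matrix.GeneralLinearGroup (Fin p) ℝ) (T : 𝕋) (ω : Ω) : Vec p :=
  glAct (a T)⁻¹ (θhat T ω - θs)

variable {Ω : Type*} [MeasurableSpace Ω] (P : Measure Ω)

/-- `θ̂_T` asymptotically maximizes `H_T(·, τ̂_T)` on `Θ`: the probability that `θ̂_T` is a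
maximizer tends to one. -/
def AsymptoticallyMaximizes (Θ : Set (Vec p)) (H : 𝕋 → Ω → Vec p → Vec q → ℝ)
    (τhat : 𝕋 → Ω → Vec q) (θhat : 𝕋 → Ω → Vec p) : Prop :=
  Tendsto (fun T : 𝕋 => P {ω | ∀ θ ∈ Θ, H T ω θ (τhat T ω) ≤ H T ω (θhat T ω) (τhat T ω)})
    atTop (𝓝 1)

/-- `limsup_{R → ∞} limsup_{T → ∞} P[sup_{U_T × 𝒯, |u| ≥ R} Z_T ≥ 1] = 0`. -/
def CondA1 (Θ : Set (Vec p)) (𝒯 : Set (Vec q)) (H : 𝕋 → Ω → Vec p → Vec q → ℝ) (θs : Vec p)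
    (a : 𝕋 → Matrix.GeneralLinearGroup (Fin p) ℝ) : Prop :=
  limsup (fun R : ℝ => limsup (fun T : 𝕋 =>
    P {ω | 1 ≤ ⨆ u ∈ {u | u ∈ localSet Θ θs a T ∧ R ≤ ‖u‖}, ⨆ τ ∈ 𝒯,
      ENNReal.ofReal (localField H θs a T ω u τ)}) atTop) atTop = 0

/-- `sup_{U_T(R) × 𝒯} |Z_T - V_T| → 0` in probability for every `R > 0`. -/
def CondA2Approx (Θ : Set (Vec p)) (𝒯 : Set (Vec q)) (H : 𝕋 → Ω → Vec p → Vec q → ℝ)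
    (θs : Vec p) (a : 𝕋 → Matrix.GeneralLinearGroup (Fin p) ℝ)
    (V : 𝕋 → Ω → C(Vec p, ℝ)) : Prop :=
  ∀ R : ℝ, 0 < R → ∀ ε : ℝ, 0 < ε → Tendsto (fun T : 𝕋 =>
    P {ω | ENNReal.ofReal ε ≤ ⨆ u ∈ localSet Θ θs a T ∩ Metric.closedBall 0 R, ⨆ τ ∈ 𝒯,
      ENNReal.ofReal |localField H θs a T ω u τ - V T ω u|}) atTop (𝓝 0)

/-- `⋂_{N ≥ 1} closure (⋃_{T ≥ N} U_T) ⊆ U`. -/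
def CondA3 (Θ : Set (Vec p)) (θs : Vec p)
    (a : 𝕋 → Matrix.GeneralLinearGroup (Fin p) ℝ) : Prop :=
  ⋂ (N : ℕ) (_ : 1 ≤ N), closure (⋃ (T : 𝕋) (_ : (N : ℝ) ≤ T), localSet Θ θs a T)
    ⊆ limitSet Θ θs a

/-- `û` is a `U`-valued random variable that almost surely is the unique maximizer of `Z`
on `U`. -/
def CondA4 (U : Set (Vec p)) (Z : Ω → C(Vec p, ℝ)) (uhat : Ω → Vec p) : Prop :=
  IsRandomElementOf U uhat ∧
    (∀ᵐ ω ∂P, IsLUB ((fun u => Z ω u) '' U) (Z ω (uhat ω))) ∧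
    ∀ᵐ ω ∂P, ∀ u ∈ U, u ≠ uhat ω → Z ω u < Z ω (uhat ω)

/-- `v̂_T`, `T ≥ T₀`, is a tight family of `U`-valued random variables that almost surely
maximize `V_T` on `U`. Values of `v̂_T` for other `T` are irrelevant. -/
def CondA5 (U : Set (Vec p)) (V : 𝕋 → Ω → C(Vec p, ℝ)) (T₀ : 𝕋) (vhat : 𝕋 → Ω → Vec p) : Prop :=
  (∀ T, T₀ ≤ T → IsRandomElementOf U (vhat T)) ∧
    (∀ T, T₀ ≤ T → ∀ᵐ ω ∂P, IsLUB ((fun u => V T ω u) '' U) (V T ω (vhat T ω))) ∧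
    IsTightMeasureSet ((fun T => P.map (vhat T)) '' {T | T₀ ≤ T})

end Local

end

/-! Both claims are instances of one bound, `eventually_measure_pair_mem_le`: if `x` and `y` are
tight and nearly maximize `V`, and `V` converges in law on balls to `Z` with a.s. unique maximizer
`u₀` on the closed set `U`, then for closed `F` the limsup of the probability of `(x, y) ∈ F` is at
most that of `(u₀, u₀) ∈ F`. Taking `x = y` and a product `F ×ˢ F` gives convergence in law; taking
`F = {ε ≤ ‖x - y‖}`, which misses the diagonal, gives `x - y → 0` in probability. Stable convergence
reduces to convergence in law by moving a weight `W ≥ 1` into the probability measure.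

For the bound, having two near-maximizers that form a pair in `F` is a closed condition on the
function, so the portmanteau theorem applies at each tolerance `δ`. As `δ → 0` these closed sets
decrease to the functions with two exact maximizers paired in `F`, and uniqueness puts both at `u₀`.

The tolerance in position is needed because the estimator competes over `U_T`, which only
approximates `U`: a point of `U` is compared through a nearby point of `U_T`. That point may leave
the ball of radius `R`, hence the ball of radius `R + 1`. -/

/-! ### Near-maximizers and closedness -/

/-- `x` lies in the ball of radius `R`, is within `δ` of `U`, and up to the tolerance `δ` both in
position and in value it maximizes `g` over `U ∩ closedBall 0 R`. -/
def IsNearMaximizer {p : ℕ} (U : Set (Vec p)) (R δ : ℝ)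
    (g : C(Metric.closedBall (0 : Vec p) (R + 1), ℝ)) (x : Metric.closedBall (0 : Vec p) (R + 1)) :
    Prop :=
  Metric.infDist (x : Vec p) U ≤ δ ∧ ‖(x : Vec p)‖ ≤ R ∧ ∀ u ∈ U, ‖u‖ ≤ R →
    ∃ u' : Metric.closedBall (0 : Vec p) (R + 1), dist (u' : Vec p) u ≤ δ ∧ g u' ≤ g x + δ

theorem IsNearMaximizer.mono {p : ℕ} {U : Set (Vec p)} {R δ δ' : ℝ}
    {g : C(Metric.closedBall (0 : Vec p) (R + 1), ℝ)} {x : Metric.closedBall (0 : Vec p) (R + 1)}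
    (h : IsNearMaximizer U R δ g x) (hδ : δ ≤ δ') : IsNearMaximizer U R δ' g x := by
  refine ⟨h.1.trans hδ, h.2.1, fun u hu huR => ?_⟩
  obtain ⟨u', h1, h2⟩ := h.2.2 u hu huR
  exact ⟨u', h1.trans hδ, by linarith⟩

theorem isClosed_setOf_exists_of_compactSpace {X Y : Type*} [TopologicalSpace X]
    [TopologicalSpace Y] [CompactSpace Y] {r : X → Y → Prop}
    (h : IsClosed {z : X × Y | r z.1 z.2}) : IsClosed {x | ∃ y, r x y} := by
  convert isClosedMap_fst_of_compactSpace _ h using 1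
  ext x
  simp

/-- Evaluation is jointly continuous on a compact ball, and the witness `u'` ranges over a compact
space, so projecting it away preserves closedness. The tolerance is a variable so that it can later
tend to `0`. -/
theorem isClosed_setOf_isNearMaximizer {p : ℕ} (U : Set (Vec p)) (R : ℝ) :
    IsClosed {z : ℝ × C(Metric.closedBall (0 : Vec p) (R + 1), ℝ) ×
      Metric.closedBall (0 : Vec p) (R + 1) | IsNearMaximizer U R z.1 z.2.1 z.2.2} := by
  have : CompactSpace (Metric.closedBall (0 : Vec p) (R + 1)) :=
    isCompact_iff_compactSpace.1 (isCompact_closedBall _ _)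
  have h1 : IsClosed {z : ℝ × C(Metric.closedBall (0 : Vec p) (R + 1), ℝ) ×
      Metric.closedBall (0 : Vec p) (R + 1) | Metric.infDist (z.2.2 : Vec p) U ≤ z.1} :=
    isClosed_le ((Metric.continuous_infDist_pt U).comp (by fun_prop)) (by fun_prop)
  have h2 : IsClosed {z : ℝ × C(Metric.closedBall (0 : Vec p) (R + 1), ℝ) ×
      Metric.closedBall (0 : Vec p) (R + 1) | ‖(z.2.2 : Vec p)‖ ≤ R} :=
    isClosed_le (by fun_prop) (by fun_prop)
  have h3 : ∀ u : Vec p, IsClosed {z : ℝ × C(Metric.closedBall (0 : Vec p) (R + 1), ℝ) ×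
      Metric.closedBall (0 : Vec p) (R + 1) | ∃ u' : Metric.closedBall (0 : Vec p) (R + 1),
        dist (u' : Vec p) u ≤ z.1 ∧ z.2.1 u' ≤ z.2.1 z.2.2 + z.1} := by
    intro u
    refine isClosed_setOf_exists_of_compactSpace ?_
    exact (isClosed_le (f := fun w : (ℝ × C(Metric.closedBall (0 : Vec p) (R + 1), ℝ) ×
        Metric.closedBall (0 : Vec p) (R + 1)) × Metric.closedBall (0 : Vec p) (R + 1) =>
        dist (w.2 : Vec p) u) (g := fun w => w.1.1) (by fun_prop) (by fun_prop)).inter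
      (isClosed_le (f := fun w : (ℝ × C(Metric.closedBall (0 : Vec p) (R + 1), ℝ) ×
        Metric.closedBall (0 : Vec p) (R + 1)) × Metric.closedBall (0 : Vec p) (R + 1) =>
        w.1.2.1 w.2) (g := fun w => w.1.2.1 w.1.2.2 + w.1.1) (by fun_prop) (by fun_prop))
  convert (h1.inter h2).inter
    (isClosed_iInter fun u => isClosed_iInter fun _ : u ∈ U => isClosed_iInter
      fun _ : ‖u‖ ≤ R => h3 u) using 1
  ext z
  simp only [IsNearMaximizer, Set.mem_inter_iff, Set.mem_iInter, Set.mem_ofPred_eq, and_assoc]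

/-- The functions that have two near-maximizers forming a pair in `F`. -/
def nearMaximizerPairSet {p : ℕ} (U : Set (Vec p)) (F : Set (Vec p × Vec p)) (R δ : ℝ) :
    Set C(Metric.closedBall (0 : Vec p) (R + 1), ℝ) :=
  {g | ∃ z : Metric.closedBall (0 : Vec p) (R + 1) × Metric.closedBall (0 : Vec p) (R + 1),
    ((z.1 : Vec p), (z.2 : Vec p)) ∈ F ∧ IsNearMaximizer U R δ g z.1 ∧ IsNearMaximizer U R δ g z.2}

theorem isClosed_setOf_mem_nearMaximizerPairSet {p : ℕ} (U : Set (Vec p))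
    {F : Set (Vec p × Vec p)} (hF : IsClosed F) (R : ℝ) :
    IsClosed {z : ℝ × C(Metric.closedBall (0 : Vec p) (R + 1), ℝ) |
      z.2 ∈ nearMaximizerPairSet U F R z.1} := by
  have : CompactSpace (Metric.closedBall (0 : Vec p) (R + 1)) :=
    isCompact_iff_compactSpace.1 (isCompact_closedBall _ _)
  let K := Metric.closedBall (0 : Vec p) (R + 1)
  refine isClosed_setOf_exists_of_compactSpace ?_
  exact (hF.preimage (f := fun z : (ℝ × C(K, ℝ)) × K × K => ((z.2.1 : Vec p), (z.2.2 : Vec p)))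
    (by fun_prop)).inter
    (((isClosed_setOf_isNearMaximizer U R).preimage
      (f := fun z : (ℝ × C(K, ℝ)) × K × K => (z.1.1, z.1.2, z.2.1)) (by fun_prop)).inter
    ((isClosed_setOf_isNearMaximizer U R).preimage
      (f := fun z : (ℝ × C(K, ℝ)) × K × K => (z.1.1, z.1.2, z.2.2)) (by fun_prop)))

theorem isClosed_nearMaximizerPairSet {p : ℕ} (U : Set (Vec p))
    {F : Set (Vec p × Vec p)} (hF : IsClosed F) (R δ : ℝ) :
    IsClosed (nearMaximizerPairSet U F R δ) :=
  (isClosed_setOf_mem_nearMaximizerPairSet U hF R).preimage (f := fun g => (δ, g)) (by fun_prop)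

theorem nearMaximizerPairSet_mono {p : ℕ} (U : Set (Vec p)) (F : Set (Vec p × Vec p)) (R : ℝ) :
    Monotone (nearMaximizerPairSet U F R) :=
  fun _ _ h _ ⟨z, hz, h1, h2⟩ => ⟨z, hz, h1.mono h, h2.mono h⟩

theorem iInter_nearMaximizerPairSet {p : ℕ} (U : Set (Vec p))
    {F : Set (Vec p × Vec p)} (hF : IsClosed F) (R : ℝ) :
    ⋂ n : ℕ, nearMaximizerPairSet U F R (1 / ((n : ℝ) + 1)) = nearMaximizerPairSet U F R 0 := by
  refine Set.Subset.antisymm (fun g hg => ?_)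
    (Set.subset_iInter fun n => nearMaximizerPairSet_mono U F R (by positivity))
  refine (isClosed_setOf_mem_nearMaximizerPairSet U hF R).mem_of_tendsto
    (f := fun n : ℕ => (1 / ((n : ℝ) + 1), g)) (b := atTop) (x := (0, g)) ?_
    (Eventually.of_forall fun n => Set.mem_iInter.1 hg n)
  exact tendsto_one_div_add_atTop_nhds_zero_nat.prodMk_nhds tendsto_const_nhds

/-- At tolerance `0`, closedness of `U` puts `x` in `U`, and the point compared with `u₀` is `u₀`
itself, so `v u₀ ≤ v x`. -/
theorem IsNearMaximizer.eq_of_unique {p : ℕ} {U : Set (Vec p)} (hU : IsClosed U) {R : ℝ}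
    {v : C(Vec p, ℝ)} {u₀ : Vec p} (hu₀ : u₀ ∈ U) (hR : ‖u₀‖ ≤ R)
    (hmax : ∀ u ∈ U, u ≠ u₀ → v u < v u₀) {x : Metric.closedBall (0 : Vec p) (R + 1)}
    (hx : IsNearMaximizer U R 0 (v.restrict _) x) : (x : Vec p) = u₀ := by
  have hxU : (x : Vec p) ∈ U :=
    (hU.mem_iff_infDist_zero ⟨u₀, hu₀⟩).2 (le_antisymm hx.1 Metric.infDist_nonneg)
  obtain ⟨u', h1, h2⟩ := hx.2.2 u₀ hu₀ hR
  have h3 : (u' : Vec p) = u₀ := dist_le_zero.1 h1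
  by_contra hne
  have h4 := hmax _ hxU hne
  have h5 : v u' ≤ v x + 0 := h2
  rw [h3] at h5
  linarith

/-! ### The argmax bound for pairs -/

section Core

variable {Ω : Type*} [MeasurableSpace Ω] {ι : Type*} {p : ℕ}

/-- The family `x` is tight along `l`, and with probability tending to one, its members in a given
ball are near-maximizers of `V`. -/
structure IsAsymptoticMaximizer (Q : Measure Ω) (l : Filter ι) (U : Set (Vec p))
    (V : ι → Ω → C(Vec p, ℝ)) (x : ι → Ω → Vec p) : Prop where
  tight : ∀ ε : ℝ≥0∞, 0 < ε → ∃ R₀ : ℝ, ∀ R ≥ R₀, ∀ᶠ i in l, Q {ω | R < ‖x i ω‖} ≤ ε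
  near : ∀ R δ : ℝ, 0 < R → 0 < δ → δ ≤ 1 → Tendsto (fun i => Q {ω | ‖x i ω‖ ≤ R ∧
    ¬ ∃ h : x i ω ∈ Metric.closedBall (0 : Vec p) (R + 1),
      IsNearMaximizer U R δ ((V i ω).restrict _) ⟨x i ω, h⟩}) l (𝓝 0)

theorem IsAsymptoticMaximizer.of_le_smul {P Q : Measure Ω} {l : Filter ι} {U : Set (Vec p)}
    {V : ι → Ω → C(Vec p, ℝ)} {x : ι → Ω → Vec p} (h : IsAsymptoticMaximizer P l U V x)
    {c : ℝ≥0∞} (hc : c ≠ ∞) (hQ : Q ≤ c • P) : IsAsymptoticMaximizer Q l U V x := by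
  have hle : ∀ s, Q s ≤ c * P s := fun s => hQ s
  constructor
  · intro ε hε
    obtain ⟨R₀, hR₀⟩ := h.tight (ε / c) (ENNReal.div_pos hε.ne' hc)
    refine ⟨R₀, fun R hR => (hR₀ R hR).mono fun i hi => (hle _).trans ?_⟩
    exact (mul_le_mul_right hi c).trans ENNReal.mul_div_le
  · intro R δ hR hδ hδ1
    have := ENNReal.Tendsto.const_mul (h.near R δ hR hδ hδ1) (Or.inr hc)
    rw [mul_zero] at this
    exact tendsto_of_tendsto_of_tendsto_of_le_of_le tendsto_const_nhds this
      (fun _ => zero_le) (fun _ => hle _)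

theorem limsup_measure_preimage_closed_le {S : Type*} [TopologicalSpace S] [HasOuterApproxClosed S]
    {Q : Measure Ω} [IsProbabilityMeasure Q] {l : Filter ι} {Y : ι → Ω → S} {Y' : Ω → S}
    (hY : ∀ i, Measurable[_, borel S] (Y i)) (hY' : Measurable[_, borel S] Y')
    (hconv : ∀ f : S →ᵇ ℝ,
      Tendsto (fun i => ∫ ω, f (Y i ω) ∂Q) l (𝓝 (∫ ω, f (Y' ω) ∂Q)))
    {A : Set S} (hA : IsClosed A) :
    limsup (fun i => Q (Y i ⁻¹' A)) l ≤ Q (Y' ⁻¹' A) := by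
  let _ : MeasurableSpace S := borel S
  have : BorelSpace S := ⟨rfl⟩
  let μs : ι → ProbabilityMeasure S :=
    fun i => ⟨Q.map (Y i), Measure.isProbabilityMeasure_map (hY i).aemeasurable⟩
  let μ : ProbabilityMeasure S :=
    ⟨Q.map Y', Measure.isProbabilityMeasure_map hY'.aemeasurable⟩
  have hlim : Tendsto μs l (𝓝 μ) := by
    rw [ProbabilityMeasure.tendsto_iff_forall_integral_tendsto]
    intro f
    have hf : ∀ ν : Measure S, AEStronglyMeasurable f ν :=
      fun ν => (BoundedContinuousFunction.continuous f).measurable.aestronglyMeasurable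
    convert hconv f using 2
    · exact integral_map (hY _).aemeasurable (hf _)
    · exact integral_map hY'.aemeasurable (hf _)
  have := ProbabilityMeasure.limsup_measure_closed_le_of_tendsto hlim hA
  have e1 : ∀ i, (μs i : Measure S) A = Q (Y i ⁻¹' A) :=
    fun i => Measure.map_apply (hY i) hA.measurableSet
  have e2 : (μ : Measure S) A = Q (Y' ⁻¹' A) := Measure.map_apply hY' hA.measurableSet
  simpa only [e1, e2] using this

theorem IsRandomFunction.measurable_restrict {V : Ω → C(Vec p, ℝ)} (hV : IsRandomFunction V)
    (s : Set (Vec p)) : Measurable[_, borel C(s, ℝ)] fun ω => (V ω).restrict s := by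
  let _ : MeasurableSpace C(Vec p, ℝ) := borel _
  have : BorelSpace C(Vec p, ℝ) := ⟨rfl⟩
  let _ : MeasurableSpace C(s, ℝ) := borel _
  have : BorelSpace C(s, ℝ) := ⟨rfl⟩
  exact (ContinuousMap.continuous_restrict s).measurable.comp hV

theorem exists_forall_measure_norm_gt_le {Q : Measure Ω} [IsFiniteMeasure Q] {x : Ω → Vec p}
    (hx : Measurable x) {ε : ℝ≥0∞} (hε : 0 < ε) : ∃ R₀ : ℝ, ∀ R ≥ R₀, Q {ω | R < ‖x ω‖} ≤ ε := by
  have h := tendsto_measure_iInter_atTop (μ := Q) (s := fun n : ℕ => {ω | (n : ℝ) < ‖x ω‖})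
    (fun n => (measurableSet_lt measurable_const hx.norm).nullMeasurableSet)
    (fun m n hmn ω (hω : (n : ℝ) < ‖x ω‖) => lt_of_le_of_lt (Nat.cast_le.2 hmn) hω)
    ⟨0, measure_ne_top _ _⟩
  have h0 : (⋂ n : ℕ, {ω | (n : ℝ) < ‖x ω‖}) = ∅ := by
    refine Set.eq_empty_of_forall_notMem fun ω hω => ?_
    obtain ⟨n, hn⟩ := exists_nat_gt ‖x ω‖
    exact absurd (Set.mem_iInter.1 hω n) (not_lt.2 hn.le)
  rw [h0, measure_empty] at h
  obtain ⟨n, hn⟩ := (h.eventually (gt_mem_nhds hε)).exists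
  exact ⟨n, fun R hR => (measure_mono fun ω (hω : R < ‖x ω‖) => lt_of_le_of_lt hR hω).trans hn.le⟩

/-- Outside events of small probability, `(x, y) ∈ F` forces `V` into the closed set of functions
with a near-maximizing pair in `F`; the portmanteau theorem passes to `Z`, and uniqueness identifies
the pair. -/
theorem eventually_measure_pair_mem_le {Q : Measure Ω} [IsProbabilityMeasure Q] {l : Filter ι}
    {U : Set (Vec p)} (hU : IsClosed U) {V : ι → Ω → C(Vec p, ℝ)} (hV : ∀ i, IsRandomFunction (V i))
    {Z : Ω → C(Vec p, ℝ)} (hZ : IsRandomFunction Z) {u₀ : Ω → Vec p} (hu₀ : IsRandomElementOf U u₀)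
    (hmax : ∀ᵐ ω ∂Q, ∀ u ∈ U, u ≠ u₀ ω → Z ω u < Z ω (u₀ ω))
    (hconv : ∀ R : ℝ, 0 < R → ∀ f : C(Metric.closedBall (0 : Vec p) R, ℝ) →ᵇ ℝ,
      Tendsto (fun i => ∫ ω, f ((V i ω).restrict _) ∂Q) l (𝓝 (∫ ω, f ((Z ω).restrict _) ∂Q)))
    {x y : ι → Ω → Vec p} (hx : IsAsymptoticMaximizer Q l U V x)
    (hy : IsAsymptoticMaximizer Q l U V y) {F : Set (Vec p × Vec p)} (hF : IsClosed F)
    {ε : ℝ≥0∞} (hε : 0 < ε) :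
    ∀ᶠ i in l, Q {ω | (x i ω, y i ω) ∈ F} ≤ Q {ω | (u₀ ω, u₀ ω) ∈ F} + ε := by
  -- Seven errors: escape of `x`, `y` and `u₀` from the ball, failure of near-maximality for `x` and
  -- `y`, replacing tolerance `0` by `δ`, and the portmanteau limit.
  set η : ℝ≥0∞ := ε / 7 with hη_def
  have hη : 0 < η := ENNReal.div_pos hε.ne' (by simp)
  have hsum : 7 * η = ε := ENNReal.mul_div_cancel (by simp) (by simp)
  obtain ⟨R₁, hR₁⟩ := hx.tight η hη
  obtain ⟨R₂, hR₂⟩ := hy.tight η hη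
  obtain ⟨R₃, hR₃⟩ := exists_forall_measure_norm_gt_le (Q := Q) hu₀.1 hη
  obtain ⟨R, hR0, hRx, hRy, hRu⟩ : ∃ R : ℝ, 0 < R ∧ R₁ ≤ R ∧ R₂ ≤ R ∧ R₃ ≤ R :=
    ⟨max 1 (max R₁ (max R₂ R₃)), by positivity, by simp, by simp, by simp⟩
  have hcl := fun δ => isClosed_nearMaximizerPairSet U hF R δ
  have hZm := hZ.measurable_restrict (Metric.closedBall (0 : Vec p) (R + 1))
  have hmeas : ∀ δ, MeasurableSet {ω | (Z ω).restrict _ ∈ nearMaximizerPairSet U F R δ} := by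
    intro δ
    let _ : MeasurableSpace C(Metric.closedBall (0 : Vec p) (R + 1), ℝ) := borel _
    have : BorelSpace C(Metric.closedBall (0 : Vec p) (R + 1), ℝ) := ⟨rfl⟩
    exact hZm (hcl δ).measurableSet
  have hlim0 : Q {ω | (Z ω).restrict _ ∈ nearMaximizerPairSet U F R 0} ≤
      Q {ω | (u₀ ω, u₀ ω) ∈ F} + η := by
    refine le_trans (le_trans (measure_mono_ae ?_) (measure_union_le _ _))
      (add_le_add_right (hR₃ R hRu) _)
    filter_upwards [hmax] with ω hω hmem
    by_cases hn : R < ‖u₀ ω‖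
    · exact Or.inr hn
    · obtain ⟨z, hzF, h1, h2⟩ := hmem
      rw [h1.eq_of_unique hU (hu₀.2 ω) (not_lt.1 hn) hω,
        h2.eq_of_unique hU (hu₀.2 ω) (not_lt.1 hn) hω] at hzF
      exact Or.inl hzF
  obtain ⟨n, hn⟩ : ∃ n : ℕ, Q {ω | (Z ω).restrict _ ∈
      nearMaximizerPairSet U F R (1 / ((n : ℝ) + 1))} ≤ Q {ω | (u₀ ω, u₀ ω) ∈ F} + η + η := by
    have h := tendsto_measure_iInter_atTop (μ := Q) (s := fun n : ℕ =>
      {ω | (Z ω).restrict _ ∈ nearMaximizerPairSet U F R (1 / ((n : ℝ) + 1))})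
      (fun n => (hmeas _).nullMeasurableSet)
      (fun m n hmn ω hω => nearMaximizerPairSet_mono U F R
        (one_div_le_one_div_of_le (by positivity) (by simpa using hmn)) hω)
      ⟨0, measure_ne_top _ _⟩
    have h0 : (⋂ n : ℕ, {ω | (Z ω).restrict _ ∈
        nearMaximizerPairSet U F R (1 / ((n : ℝ) + 1))}) =
        {ω | (Z ω).restrict _ ∈ nearMaximizerPairSet U F R 0} := by
      rw [← iInter_nearMaximizerPairSet U hF R]
      ext ω
      simp
    rw [h0] at h
    have hlt : Q {ω | (Z ω).restrict _ ∈ nearMaximizerPairSet U F R 0} <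
        Q {ω | (u₀ ω, u₀ ω) ∈ F} + η + η :=
      lt_of_lt_of_le (ENNReal.lt_add_right (measure_ne_top _ _) hη.ne')
        (add_le_add_left hlim0 _)
    obtain ⟨n, hn⟩ := (h.eventually (gt_mem_nhds hlt)).exists
    exact ⟨n, hn.le⟩
  set δ : ℝ := 1 / ((n : ℝ) + 1) with hδ_def
  have hδ : 0 < δ := by positivity
  have hδ1 : δ ≤ 1 := by
    rw [hδ_def, div_le_one (by positivity)]
    linarith [(Nat.cast_nonneg n : (0 : ℝ) ≤ n)]
  have hport : limsup (fun i => Q {ω | (V i ω).restrict _ ∈ nearMaximizerPairSet U F R δ}) l ≤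
      Q {ω | (Z ω).restrict _ ∈ nearMaximizerPairSet U F R δ} := by
    have : CompactSpace (Metric.closedBall (0 : Vec p) (R + 1)) :=
      isCompact_iff_compactSpace.1 (isCompact_closedBall _ _)
    exact limsup_measure_preimage_closed_le (fun i => (hV i).measurable_restrict _) hZm
      (hconv (R + 1) (by linarith)) (hcl δ)
  have hport' := eventually_lt_of_limsup_lt
    (lt_of_le_of_lt hport (ENNReal.lt_add_right (measure_ne_top _ _) hη.ne'))
  filter_upwards [hR₁ R hRx, hR₂ R hRy, hport',
    (hx.near R δ hR0 hδ hδ1).eventually (gt_mem_nhds hη),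
    (hy.near R δ hR0 hδ hδ1).eventually (gt_mem_nhds hη)] with i h1 h2 h3 h4 h5
  refine (measure_mono (t := ({ω | R < ‖x i ω‖} ∪ {ω | R < ‖y i ω‖}) ∪
    ({ω | ‖x i ω‖ ≤ R ∧ ¬ ∃ h : x i ω ∈ Metric.closedBall (0 : Vec p) (R + 1),
      IsNearMaximizer U R δ ((V i ω).restrict _) ⟨x i ω, h⟩} ∪
    {ω | ‖y i ω‖ ≤ R ∧ ¬ ∃ h : y i ω ∈ Metric.closedBall (0 : Vec p) (R + 1),
      IsNearMaximizer U R δ ((V i ω).restrict _) ⟨y i ω, h⟩}) ∪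
    {ω | (V i ω).restrict _ ∈ nearMaximizerPairSet U F R δ}) ?_).trans ?_
  · intro ω hω
    by_contra hcon
    simp only [Set.mem_union, not_or, Set.mem_ofPred_eq, not_and, not_not, not_lt] at hcon
    obtain ⟨⟨⟨hxR, hyR⟩, hxn, hyn⟩, hnot⟩ := hcon
    obtain ⟨hx', hx''⟩ := hxn hxR
    obtain ⟨hy', hy''⟩ := hyn hyR
    exact hnot ⟨(⟨_, hx'⟩, ⟨_, hy'⟩), hω, hx'', hy''⟩
  · calc _ ≤ ((η + η) + (η + η)) + ((Q {ω | (u₀ ω, u₀ ω) ∈ F} + η + η) + η) := by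
          refine (measure_union_le _ _).trans (add_le_add ((measure_union_le _ _).trans
            (add_le_add ((measure_union_le _ _).trans (add_le_add h1 h2))
              ((measure_union_le _ _).trans (add_le_add h4.le h5.le)))) ?_)
          exact h3.le.trans (add_le_add_left hn _)
      _ = Q {ω | (u₀ ω, u₀ ω) ∈ F} + 7 * η := by ring
      _ = _ := by rw [hsum]

end Core

/-! ### Local parameter sets and their limit -/

section LocalSets

variable {𝕋 : Set ℝ} {p q : ℕ}

theorem eventually_le_coe_atTop (h𝕋 : ¬ BddAbove 𝕋) (c : ℝ) : ∀ᶠ T : 𝕋 in atTop, c ≤ (T : ℝ) := by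
  obtain ⟨t, ht, hct⟩ := not_bddAbove_iff.1 h𝕋 c
  exact (eventually_ge_atTop (⟨t, ht⟩ : 𝕋)).mono fun T hT => hct.le.trans hT

theorem isCountablyGenerated_atTop_of_not_bddAbove (h𝕋 : ¬ BddAbove 𝕋) :
    (atTop : Filter 𝕋).IsCountablyGenerated := by
  rw [← comap_embedding_atTop (e := ((↑) : 𝕋 → ℝ)) (fun _ _ => Iff.rfl) fun c => by
    obtain ⟨t, ht, hct⟩ := not_bddAbove_iff.1 h𝕋 c
    exact ⟨⟨t, ht⟩, hct.le⟩]
  infer_instance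

theorem glAct_glAct_inv (A : Matrix.GeneralLinearGroup (Fin p) ℝ) (u : Vec p) :
    glAct A (glAct A⁻¹ u) = u := by
  have h : (A : Matrix (Fin p) (Fin p) ℝ) * (A⁻¹ : Matrix.GeneralLinearGroup (Fin p) ℝ) = 1 := by
    rw [← Units.val_mul, mul_inv_cancel, Units.val_one]
  ext i
  simp [glAct, Matrix.toLpLin_apply, Matrix.mulVec_mulVec, h, -Matrix.coe_units_inv]

@[simp]
theorem glAct_zero (A : Matrix.GeneralLinearGroup (Fin p) ℝ) : glAct A 0 = 0 := by
  simp [glAct]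

theorem measurable_glAct (A : Matrix.GeneralLinearGroup (Fin p) ℝ) :
    Measurable (glAct A : Vec p → Vec p) :=
  (LinearMap.continuous_of_finiteDimensional
    (Matrix.toEuclideanLin (A : Matrix (Fin p) (Fin p) ℝ))).measurable

theorem add_glAct_rescaled {Ω : Type*} (θhat : 𝕋 → Ω → Vec p) (θs : Vec p)
    (a : 𝕋 → Matrix.GeneralLinearGroup (Fin p) ℝ) (T : 𝕋) (ω : Ω) :
    θs + glAct (a T) (rescaled θhat θs a T ω) = θhat T ω := by
  simp [rescaled, glAct_glAct_inv]

variable {Θ : Set (Vec p)} {θs : Vec p} {a : 𝕋 → Matrix.GeneralLinearGroup (Fin p) ℝ}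

theorem zero_mem_localSet (hθs : θs ∈ Θ) (T : 𝕋) : (0 : Vec p) ∈ localSet Θ θs a T := by
  simpa [localSet] using hθs

theorem mem_limitSet (u : Vec p) : u ∈ limitSet Θ θs a ↔ ∀ δ : ℝ, 0 < δ → ∃ N : ℕ, 1 ≤ N ∧
    ∀ T : 𝕋, (N : ℝ) ≤ T → u ∈ Metric.thickening δ (localSet Θ θs a T) := by
  simp [limitSet]

theorem isClosed_limitSet : IsClosed (limitSet Θ θs a) := by
  refine isClosed_of_closure_subset fun u hu => (mem_limitSet u).2 fun δ hδ => ?_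
  obtain ⟨v, hv, huv⟩ := Metric.mem_closure_iff.1 hu (δ / 2) (half_pos hδ)
  obtain ⟨N, hN, h⟩ := (mem_limitSet v).1 hv (δ / 2) (half_pos hδ)
  refine ⟨N, hN, fun T hT => ?_⟩
  obtain ⟨w, hw, hvw⟩ := Metric.mem_thickening_iff.1 (h T hT)
  exact Metric.mem_thickening_iff.2 ⟨w, hw, by linarith [dist_triangle u v w]⟩

/-- The definition of `U` gives a threshold for each point; compactness makes it uniform on balls,
half of `δ` being spent on the covering. -/
theorem eventually_inter_closedBall_subset_thickening (h𝕋 : ¬ BddAbove 𝕋) (R : ℝ) {δ : ℝ}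
    (hδ : 0 < δ) : ∀ᶠ T in atTop, limitSet Θ θs a ∩ Metric.closedBall 0 R ⊆
      Metric.thickening δ (localSet Θ θs a T) := by
  have hc : IsCompact (limitSet Θ θs a ∩ Metric.closedBall 0 R) :=
    (isCompact_closedBall _ _).inter_left isClosed_limitSet
  refine hc.induction_on (p := fun s => ∀ᶠ T in atTop, s ⊆
    Metric.thickening δ (localSet Θ θs a T)) (by simp) (fun s t hst ht => ht.mono fun T hT =>
      hst.trans hT) (fun s t hs ht => (hs.and ht).mono fun T hT => Set.union_subset hT.1 hT.2) ?_
  intro u hu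
  obtain ⟨N, -, h⟩ := (mem_limitSet u).1 hu.1 (δ / 2) (half_pos hδ)
  refine ⟨Metric.ball u (δ / 2), mem_nhdsWithin_of_mem_nhds (Metric.ball_mem_nhds u (half_pos hδ)),
    (eventually_le_coe_atTop h𝕋 N).mono fun T hT v hv => ?_⟩
  obtain ⟨w, hw, huw⟩ := Metric.mem_thickening_iff.1 (h T hT)
  exact Metric.mem_thickening_iff.2 ⟨w, hw, by
    linarith [dist_triangle v u w, Metric.mem_ball.1 hv]⟩

/-- By [A3], a point at distance at least `δ` from `U` has a neighbourhood missing every `U_T` with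
`T` large. Finitely many such neighbourhoods cover the compact set of these points in the ball. -/
theorem CondA3.eventually_infDist_le (hA3 : CondA3 Θ θs a) (h𝕋 : ¬ BddAbove 𝕋) (R : ℝ) {δ : ℝ}
    (hδ : 0 < δ) : ∀ᶠ T in atTop, ∀ u ∈ localSet Θ θs a T, ‖u‖ ≤ R →
      Metric.infDist u (limitSet Θ θs a) ≤ δ := by
  have hc : IsCompact ({u | δ ≤ Metric.infDist u (limitSet Θ θs a)} ∩ Metric.closedBall 0 R) :=
    (isCompact_closedBall _ _).inter_left
      (isClosed_le continuous_const (Metric.continuous_infDist_pt _))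
  have key : ∀ᶠ T in atTop, ∀ u ∈ {u | δ ≤ Metric.infDist u (limitSet Θ θs a)} ∩
      Metric.closedBall 0 R, u ∉ localSet Θ θs a T := by
    refine hc.induction_on (p := fun s => ∀ᶠ T in atTop, ∀ u ∈ s, u ∉ localSet Θ θs a T) (by simp)
      (fun s t hst ht => ht.mono fun T hT u hu => hT u (hst hu))
      (fun s t hs ht => (hs.and ht).mono fun T hT u hu => hu.elim (hT.1 u) (hT.2 u)) ?_
    intro u hu
    have hnot : u ∉ limitSet Θ θs a := fun h => by
      have h1 : δ ≤ Metric.infDist u (limitSet Θ θs a) := hu.1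
      rw [Metric.infDist_zero_of_mem h] at h1
      linarith
    have hnot' : u ∉ ⋂ (N : ℕ) (_ : 1 ≤ N),
        closure (⋃ (T : 𝕋) (_ : (N : ℝ) ≤ T), localSet Θ θs a T) := fun h => hnot (hA3 h)
    simp only [Set.mem_iInter, not_forall] at hnot'
    obtain ⟨N, -, hN⟩ := hnot'
    refine ⟨_, mem_nhdsWithin_of_mem_nhds (isClosed_closure.isOpen_compl.mem_nhds hN),
      (eventually_le_coe_atTop h𝕋 N).mono fun T hT v hv hvT => hv (subset_closure ?_)⟩
    exact Set.mem_iUnion₂.2 ⟨T, hT, hvT⟩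
  filter_upwards [key] with T hT u hu huR
  by_contra hcon
  exact hT u ⟨(not_le.1 hcon).le, by simpa using huR⟩ hu

theorem localField_le_localField_rescaled {Ω : Type*} {H : 𝕋 → Ω → Vec p → Vec q → ℝ}
    {τhat : 𝕋 → Ω → Vec q} {θhat : 𝕋 → Ω → Vec p} {T : 𝕋} {ω : Ω}
    (h : ∀ θ ∈ Θ, H T ω θ (τhat T ω) ≤ H T ω (θhat T ω) (τhat T ω)) {u : Vec p}
    (hu : u ∈ localSet Θ θs a T) :
    localField H θs a T ω u (τhat T ω) ≤
      localField H θs a T ω (rescaled θhat θs a T ω) (τhat T ω) := by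
  rw [localField, localField, add_glAct_rescaled]
  exact Real.exp_le_exp.2 (sub_le_sub_right (h _ hu) _)

end LocalSets

/-! ### The estimators as asymptotic maximizers -/

section Fields

variable {Ω : Type*} [MeasurableSpace Ω] {p q : ℕ} {Θ : Set (Vec p)} {𝒯 : Set (Vec q)}

theorem IsContinuousRandomField.measurable_comp {h : Ω → Vec p → Vec q → ℝ}
    (hh : IsContinuousRandomField Θ 𝒯 h) {X : Ω → Vec p} (hX : IsRandomElementOf Θ X)
    {Y : Ω → Vec q} (hY : IsRandomElementOf 𝒯 Y) : Measurable fun ω => h ω (X ω) (Y ω) := by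
  have hu : Measurable (Function.uncurry
      fun (ξ : Θ × 𝒯) (ω : Ω) => h ω (ξ.1 : Vec p) (ξ.2 : Vec q)) := by
    refine measurable_uncurry_of_continuous_of_measurable (fun ω => ?_)
      fun ξ => hh.1 _ ξ.1.2 _ ξ.2.2
    exact (hh.2 ω).comp_continuous (f := fun ξ : Θ × 𝒯 => ((ξ.1 : Vec p), (ξ.2 : Vec q)))
      (by fun_prop) fun ξ => ⟨ξ.1.2, ξ.2.2⟩
  exact hu.comp (((hX.1.subtype_mk (h := hX.2)).prodMk (hY.1.subtype_mk (h := hY.2))).prodMk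
    measurable_id)

/-- By continuity in `θ`, a countable dense subset of `Θ` suffices. Measurability is what allows the
complement to be given probability tending to `0`. -/
theorem IsContinuousRandomField.measurableSet_isMax {h : Ω → Vec p → Vec q → ℝ}
    (hh : IsContinuousRandomField Θ 𝒯 h) {X : Ω → Vec p} (hX : IsRandomElementOf Θ X)
    {Y : Ω → Vec q} (hY : IsRandomElementOf 𝒯 Y) :
    MeasurableSet {ω | ∀ θ ∈ Θ, h ω θ (Y ω) ≤ h ω (X ω) (Y ω)} := by
  rcases isEmpty_or_nonempty Θ with hΘ | hΘ
  · have : {ω | ∀ θ ∈ Θ, h ω θ (Y ω) ≤ h ω (X ω) (Y ω)} = Set.univ :=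
      Set.eq_univ_of_forall fun ω θ hθ => (hΘ.false ⟨θ, hθ⟩).elim
    rw [this]
    exact MeasurableSet.univ
  have hset : {ω | ∀ θ ∈ Θ, h ω θ (Y ω) ≤ h ω (X ω) (Y ω)} = ⋂ n : ℕ,
      {ω | h ω (TopologicalSpace.denseSeq Θ n) (Y ω) ≤ h ω (X ω) (Y ω)} := by
    ext ω
    simp only [Set.mem_ofPred_eq, Set.mem_iInter]
    refine ⟨fun H n => H _ (TopologicalSpace.denseSeq Θ n).2, fun H θ hθ => ?_⟩
    refine (TopologicalSpace.denseRange_denseSeq Θ).induction_on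
      (p := fun θ : Θ => h ω θ (Y ω) ≤ h ω (X ω) (Y ω)) ⟨θ, hθ⟩ (isClosed_le ?_ continuous_const) H
    exact (hh.2 ω).comp_continuous (f := fun θ : Θ => ((θ : Vec p), Y ω)) (by fun_prop)
      fun θ => ⟨θ.2, hY.2 ω⟩
  rw [hset]
  exact MeasurableSet.iInter fun n => measurableSet_le
    (hh.measurable_comp ⟨measurable_const, fun _ => (TopologicalSpace.denseSeq Θ n).2⟩ hY)
    (hh.measurable_comp hX hY)

variable {𝕋 : Set ℝ} {P : Measure Ω} {θs : Vec p} {a : 𝕋 → Matrix.GeneralLinearGroup (Fin p) ℝ}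
  {H : 𝕋 → Ω → Vec p → Vec q → ℝ} {τhat : 𝕋 → Ω → Vec q} {θhat : 𝕋 → Ω → Vec p}
  {V : 𝕋 → Ω → C(Vec p, ℝ)}

theorem AsymptoticallyMaximizes.tendsto_measure_compl [IsProbabilityMeasure P]
    (hmax : AsymptoticallyMaximizes P Θ H τhat θhat)
    (hH : ∀ T, IsContinuousRandomField Θ 𝒯 (H T)) (hτhat : ∀ T, IsRandomElementOf 𝒯 (τhat T))
    (hθhat : ∀ T, IsRandomElementOf Θ (θhat T)) :
    Tendsto (fun T : 𝕋 => P {ω | ∀ θ ∈ Θ, H T ω θ (τhat T ω) ≤ H T ω (θhat T ω) (τhat T ω)}ᶜ)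
      atTop (𝓝 0) := by
  have h := ENNReal.Tendsto.sub (tendsto_const_nhds (x := (1 : ℝ≥0∞))) hmax (Or.inl (by simp))
  rw [tsub_self] at h
  refine h.congr fun T => ?_
  rw [prob_compl_eq_one_sub ((hH T).measurableSet_isMax (hθhat T) (hτhat T))]

theorem measurable_rescaled (hθhat : ∀ T, IsRandomElementOf Θ (θhat T)) (T : 𝕋) :
    Measurable (rescaled θhat θs a T) :=
  (measurable_glAct _).comp ((hθhat T).1.sub_const θs)

theorem rescaled_mem_localSet (hθhat : ∀ T, IsRandomElementOf Θ (θhat T)) (T : 𝕋) (ω : Ω) :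
    rescaled θhat θs a T ω ∈ localSet Θ θs a T := by
  have h := (hθhat T).2 ω
  rwa [← add_glAct_rescaled θhat θs a T ω] at h

/-- Tightness: `Z_T = 1` at `u = 0`, so a maximizer outside the ball triggers the event in [A1].
Near-maximality: [A3] keeps the estimator close to `U`, each `u ∈ U` is close to some `w ∈ U_T`, and
[A2] transfers the comparison at `w` from `Z_T` to `V_T`. -/
theorem isAsymptoticMaximizer_rescaled [IsProbabilityMeasure P] (h𝕋 : ¬ BddAbove 𝕋)
    (hθs : θs ∈ Θ) (hH : ∀ T, IsContinuousRandomField Θ 𝒯 (H T))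
    (hτhat : ∀ T, IsRandomElementOf 𝒯 (τhat T)) (hθhat : ∀ T, IsRandomElementOf Θ (θhat T))
    (hmax : AsymptoticallyMaximizes P Θ H τhat θhat) (hA1 : CondA1 P Θ 𝒯 H θs a)
    (hA2 : CondA2Approx P Θ 𝒯 H θs a V) (hA3 : CondA3 Θ θs a) :
    IsAsymptoticMaximizer P atTop (limitSet Θ θs a) V (rescaled θhat θs a) := by
  have hcompl := hmax.tendsto_measure_compl hH hτhat hθhat
  constructor
  · intro ε hε
    have hε2 : 0 < ε / 2 := ENNReal.half_pos hε.ne'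
    have h1 := eventually_lt_of_limsup_lt (show limsup (fun R : ℝ => limsup (fun T : 𝕋 =>
      P {ω | 1 ≤ ⨆ u ∈ {u | u ∈ localSet Θ θs a T ∧ R ≤ ‖u‖}, ⨆ τ ∈ 𝒯,
        ENNReal.ofReal (localField H θs a T ω u τ)}) atTop) atTop < ε / 2 from
      lt_of_eq_of_lt hA1 hε2)
    obtain ⟨R₀, hR₀⟩ := eventually_atTop.1 h1
    refine ⟨R₀, fun R hR => ?_⟩
    filter_upwards [eventually_lt_of_limsup_lt (hR₀ R hR),
      hcompl.eventually (gt_mem_nhds hε2)] with T hT1 hT2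
    refine (measure_mono ?_).trans ((measure_union_le _ _).trans
      ((add_le_add hT2.le hT1.le).trans (ENNReal.add_halves ε).le))
    intro ω hω
    by_cases hω' : ∀ θ ∈ Θ, H T ω θ (τhat T ω) ≤ H T ω (θhat T ω) (τhat T ω)
    · refine Or.inr ?_
      have h0 := localField_le_localField_rescaled hω' (zero_mem_localSet (a := a) hθs T)
      have h0' : localField H θs a T ω 0 (τhat T ω) = 1 := by simp [localField]
      rw [h0'] at h0
      have hω1 : R < ‖rescaled θhat θs a T ω‖ := hω
      change 1 ≤ ⨆ u ∈ {u | u ∈ localSet Θ θs a T ∧ R ≤ ‖u‖}, ⨆ τ ∈ 𝒯,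
        ENNReal.ofReal (localField H θs a T ω u τ)
      refine le_iSup₂_of_le (rescaled θhat θs a T ω)
        ⟨rescaled_mem_localSet hθhat T ω, hω1.le⟩
        (le_iSup₂_of_le (τhat T ω) ((hτhat T).2 ω) ?_)
      rw [← ENNReal.ofReal_one]
      exact ENNReal.ofReal_le_ofReal h0
    · exact Or.inl hω'
  · intro R δ hR hδ hδ1
    -- The approximation is used at two points, hence `δ / 2`; the radius `R + 1` accommodates `w`,
    -- as `δ ≤ 1`.
    have h1 := hA2 (R + 1) (by linarith) (δ / 2) (half_pos hδ)
    have hsum := hcompl.add h1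
    rw [add_zero] at hsum
    refine tendsto_of_tendsto_of_tendsto_of_le_of_le' tendsto_const_nhds hsum
      (Eventually.of_forall fun _ => zero_le) ?_
    filter_upwards [hA3.eventually_infDist_le h𝕋 R hδ,
      eventually_inter_closedBall_subset_thickening (Θ := Θ) (θs := θs) (a := a) h𝕋 R hδ]
      with T hT1 hT2
    refine (measure_mono ?_).trans (measure_union_le _ _)
    rintro ω ⟨hωR, hω⟩
    by_contra hcon
    simp only [Set.mem_union, not_or, Set.mem_compl_iff, not_not, Set.mem_ofPred_eq, not_le] at hcon
    obtain ⟨hωmax, hωsup⟩ := hcon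
    have happrox : ∀ u ∈ localSet Θ θs a T, ‖u‖ ≤ R + 1 →
        |localField H θs a T ω u (τhat T ω) - V T ω u| < δ / 2 := by
      intro u hu huR
      have h2 := lt_of_le_of_lt (le_iSup₂_of_le u ⟨hu, by simpa using huR⟩
        (le_iSup₂_of_le (τhat T ω) ((hτhat T).2 ω) le_rfl)) hωsup
      exact (ENNReal.ofReal_lt_ofReal_iff (half_pos hδ)).1 h2
    have hmem := rescaled_mem_localSet (θs := θs) (a := a) hθhat T ω
    refine hω ⟨mem_closedBall_zero_iff.2 (by linarith), hT1 _ hmem hωR, hωR, fun u hu huR => ?_⟩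
    obtain ⟨w, hw, huw⟩ := Metric.mem_thickening_iff.1 (hT2 ⟨hu, by simpa using huR⟩)
    have hwR : ‖w‖ ≤ R + 1 := by
      have := norm_le_norm_add_norm_sub u w
      rw [← dist_eq_norm] at this
      linarith
    refine ⟨⟨w, mem_closedBall_zero_iff.2 hwR⟩, by rw [dist_comm]; exact huw.le, ?_⟩
    change V T ω w ≤ V T ω (rescaled θhat θs a T ω) + δ
    have e1 := (abs_lt.1 (happrox w hw hwR)).1
    have e2 := (abs_lt.1 (happrox _ hmem (by linarith))).2
    have e3 := localField_le_localField_rescaled hωmax hw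
    linarith

theorem CondA5.isAsymptoticMaximizer {U : Set (Vec p)} {T₀ : 𝕋} {vhat : 𝕋 → Ω → Vec p}
    (h : CondA5 P U V T₀ vhat) : IsAsymptoticMaximizer P atTop U V vhat := by
  obtain ⟨hmem, hlub, htight⟩ := h
  constructor
  · intro ε hε
    have h1 := tendsto_measure_norm_gt_of_isTightMeasureSet htight
    obtain ⟨R₀, hR₀⟩ := eventually_atTop.1 (h1.eventually (gt_mem_nhds hε))
    refine ⟨R₀, fun R hR => (eventually_ge_atTop T₀).mono fun T hT => ?_⟩
    have h2 : (P.map (vhat T)) {x | R < ‖x‖} ≤ ε :=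
      (le_iSup₂ (f := fun μ (_ : μ ∈ (fun T => P.map (vhat T)) '' {T | T₀ ≤ T}) =>
        μ {x | R < ‖x‖}) _ ⟨T, hT, rfl⟩).trans (hR₀ R hR).le
    rwa [Measure.map_apply (hmem T hT).1 (measurableSet_lt measurable_const measurable_norm)] at h2
  · intro R δ hR hδ hδ1
    -- For `T ≥ T₀` the bad event is null: the maximizer is exact and `u' = u` serves.
    refine tendsto_const_nhds.congr' ((eventually_ge_atTop T₀).mono fun T hT => ?_)
    refine (measure_eq_zero_iff_ae_notMem.2 ?_).symm
    filter_upwards [hlub T hT] with ω hω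
    rintro ⟨hωR, hnot⟩
    have hR1 : ‖vhat T ω‖ ≤ R + 1 := by linarith
    refine hnot ⟨mem_closedBall_zero_iff.2 hR1, ?_, hωR, fun u hu huR =>
      ⟨⟨u, mem_closedBall_zero_iff.2 (by linarith)⟩, by simpa using hδ.le, ?_⟩⟩
    · change Metric.infDist (vhat T ω) U ≤ δ
      rw [Metric.infDist_zero_of_mem ((hmem T hT).2 ω)]
      exact hδ.le
    · change V T ω u ≤ V T ω (vhat T ω) + δ
      linarith [hω.1 ⟨u, hu, rfl⟩]

end Fields

/-! ### Stable convergence by change of measure -/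

section StableConvergence

variable {Ω : Type*} {𝒢 : MeasurableSpace Ω} [mΩ : MeasurableSpace Ω] {P : Measure Ω}
  [IsProbabilityMeasure P] {ι : Type*} {l : Filter ι}

/-- `Q` has density `W / m` with `m = E[W] ≥ 1`, so the density is at most `C`. This domination
carries the asymptotic maximizer property over to `Q`. -/
theorem exists_isProbabilityMeasure_integral_mul_eq {W : Ω → ℝ} (hW : Measurable W) {C : ℝ}
    (h1 : ∀ ω, 1 ≤ W ω) (hC : ∀ ω, W ω ≤ C) : ∃ (Q : Measure Ω) (m : ℝ), IsProbabilityMeasure Q ∧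
      0 < m ∧ Q ≤ ENNReal.ofReal C • P ∧ ∀ g : Ω → ℝ, ∫ ω, g ω * W ω ∂P = m * ∫ ω, g ω ∂Q := by
  have hint : Integrable W P := Integrable.of_bound hW.aestronglyMeasurable C
    (Eventually.of_forall fun ω => by rw [Real.norm_eq_abs, abs_of_nonneg] <;> linarith [h1 ω, hC ω])
  set m := ∫ ω, W ω ∂P with hm
  have hm1 : 1 ≤ m := by
    calc (1 : ℝ) = ∫ _, (1 : ℝ) ∂P := by simp
      _ ≤ m := integral_mono (integrable_const _) hint h1
  have hm0 : 0 < m := by linarith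
  have hWm : Measurable fun ω => ENNReal.ofReal (W ω / m) := (hW.div_const m).ennreal_ofReal
  refine ⟨P.withDensity fun ω => ENNReal.ofReal (W ω / m), m, ⟨?_⟩, hm0, ?_, fun g => ?_⟩
  · rw [withDensity_apply _ MeasurableSet.univ, Measure.restrict_univ,
      ← ofReal_integral_eq_lintegral_ofReal (hint.div_const m) (Eventually.of_forall fun ω =>
        div_nonneg (by linarith [h1 ω]) hm0.le), integral_div, ← hm, div_self hm0.ne',
      ENNReal.ofReal_one]
  · rw [← withDensity_const]
    refine withDensity_mono (Eventually.of_forall fun ω => ENNReal.ofReal_le_ofReal ?_)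
    exact (div_le_self (by linarith [h1 ω]) hm1).trans (hC ω)
  · rw [integral_withDensity_eq_integral_toReal_smul hWm (by simp), ← integral_const_mul]
    refine integral_congr_ae (Eventually.of_forall fun ω => ?_)
    have : 0 ≤ W ω / m := div_nonneg (by linarith [h1 ω]) hm0.le
    simp only [ENNReal.toReal_ofReal this, smul_eq_mul]
    field_simp

theorem tendsto_integral_of_forall_eventually_measure_le {S : Type*} [TopologicalSpace S]
    [MeasurableSpace S] [BorelSpace S] [l.IsCountablyGenerated] {Y : ι → Ω → S} {Y' : Ω → S}
    (hY : ∀ i, Measurable (Y i)) (hY' : Measurable Y')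
    (h : ∀ F : Set S, IsClosed F → ∀ ε : ℝ≥0∞, 0 < ε →
      ∀ᶠ i in l, P (Y i ⁻¹' F) ≤ P (Y' ⁻¹' F) + ε) (f : S →ᵇ ℝ) :
    Tendsto (fun i => ∫ ω, f (Y i ω) ∂P) l (𝓝 (∫ ω, f (Y' ω) ∂P)) := by
  let μs : ι → ProbabilityMeasure S :=
    fun i => ⟨P.map (Y i), Measure.isProbabilityMeasure_map (hY i).aemeasurable⟩
  let μ : ProbabilityMeasure S :=
    ⟨P.map Y', Measure.isProbabilityMeasure_map hY'.aemeasurable⟩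
  have hlim : Tendsto μs l (𝓝 μ) := by
    refine tendsto_of_forall_isClosed_limsup_le' fun F hF => ?_
    refine ENNReal.le_of_forall_pos_le_add fun ε hε _ => ?_
    refine limsup_le_of_le (by isBoundedDefault) ?_
    filter_upwards [h F hF ε (by exact_mod_cast hε)] with i hi
    have e1 : (μs i : Measure S) F = P (Y i ⁻¹' F) := Measure.map_apply (hY i) hF.measurableSet
    have e2 : (μ : Measure S) F = P (Y' ⁻¹' F) := Measure.map_apply hY' hF.measurableSet
    rwa [e1, e2]
  have hf : ∀ ν : Measure S, AEStronglyMeasurable f ν :=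
    fun ν => (BoundedContinuousFunction.continuous f).measurable.aestronglyMeasurable
  have := ProbabilityMeasure.tendsto_iff_forall_integral_tendsto.1 hlim f
  convert this using 2
  · exact (integral_map (hY _).aemeasurable (hf _)).symm
  · exact (integral_map hY'.aemeasurable (hf _)).symm

/-- If `|W| ≤ C`, then `W + (C + 1) ≥ 1`; by linearity, subtract `C + 1` times the case of constant
weight `1`. -/
theorem StablyConverges.of_one_le {S : Type*} [TopologicalSpace S] [MeasurableSpace S]
    [BorelSpace S] (h𝒢 : 𝒢 ≤ mΩ) {Y : ι → Ω → S} {Y' : Ω → S} (hY : ∀ i, Measurable (Y i))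
    (hY' : Measurable Y')
    (h : ∀ (f : S →ᵇ ℝ) (W : Ω → ℝ) (C : ℝ), Measurable[𝒢] W → (∀ ω, 1 ≤ W ω) → (∀ ω, W ω ≤ C) →
      Tendsto (fun i => ∫ ω, f (Y i ω) * W ω ∂P) l (𝓝 (∫ ω, f (Y' ω) * W ω ∂P))) :
    StablyConverges 𝒢 P l Y Y' := by
  rintro f W hW ⟨C, hC⟩
  have hint : ∀ X : Ω → S, Measurable X → ∀ W' : Ω → ℝ, Measurable[𝒢] W' →
      (∃ C', ∀ ω, |W' ω| ≤ C') → Integrable (fun ω => f (X ω) * W' ω) P := by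
    rintro X hX W' hW' ⟨C', hC'⟩
    refine Integrable.of_bound ((f.continuous.measurable.comp hX).mul
      (hW'.mono h𝒢 le_rfl)).aestronglyMeasurable (‖f‖ * C') (Eventually.of_forall fun ω => ?_)
    rw [norm_mul]
    exact mul_le_mul (f.norm_coe_le_norm _) (hC' ω) (norm_nonneg _) (norm_nonneg _)
  have hsplit : ∀ X : Ω → S, Measurable X → ∫ ω, f (X ω) * W ω ∂P =
      ∫ ω, f (X ω) * (W ω + (C + 1)) ∂P - (C + 1) * ∫ ω, f (X ω) * (1 : ℝ) ∂P := by
    intro X hX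
    have e : ∀ ω, f (X ω) * (W ω + (C + 1)) = f (X ω) * W ω + (C + 1) * (f (X ω) * 1) :=
      fun ω => by ring
    simp_rw [e]
    rw [integral_add (hint X hX W hW ⟨C, hC⟩)
      ((hint X hX (fun _ => 1) measurable_const ⟨1, by simp⟩).const_mul _), integral_const_mul]
    ring
  have h1 := h f (fun ω => W ω + (C + 1)) (C + (C + 1)) (hW.add_const _)
    (fun ω => by linarith [(abs_le.1 (hC ω)).1]) (fun ω => by linarith [(abs_le.1 (hC ω)).2])
  have h2 := h f (fun _ => 1) 1 measurable_const (fun _ => le_rfl) (fun _ => le_rfl)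
  rw [hsplit _ hY']
  exact (h1.sub (h2.const_mul (C + 1))).congr fun i => (hsplit _ (hY i)).symm

end StableConvergence

/-! ### The main theorem -/

theorem theorem1 {Ω : Type*} (𝒢 : MeasurableSpace Ω) [mΩ : MeasurableSpace Ω] (h𝒢 : 𝒢 ≤ mΩ)
    (P : Measure Ω) [IsProbabilityMeasure P]
    (𝕋 : Set ℝ) (h𝕋 : ¬ BddAbove 𝕋)
    {p q : ℕ} (Θ : Set (Vec p)) (hΘ : MeasurableSet Θ) (𝒯 : Set (Vec q)) (h𝒯 : MeasurableSet 𝒯)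
    (θs : Vec p) (hθs : θs ∈ Θ)
    (H : 𝕋 → Ω → Vec p → Vec q → ℝ) (hH : ∀ T, IsContinuousRandomField Θ 𝒯 (H T))
    (τhat : 𝕋 → Ω → Vec q) (hτhat : ∀ T, IsRandomElementOf 𝒯 (τhat T))
    (θhat : 𝕋 → Ω → Vec p) (hθhat : ∀ T, IsRandomElementOf Θ (θhat T))
    (hmax : AsymptoticallyMaximizes P Θ H τhat θhat)
    (a : 𝕋 → Matrix.GeneralLinearGroup (Fin p) ℝ)
    (ha : Tendsto (fun T => traceNorm (a T : Matrix (Fin p) (Fin p) ℝ)) atTop (𝓝 0))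
    (V : 𝕋 → Ω → C(Vec p, ℝ)) (hV : ∀ T, IsRandomFunction (V T))
    (Z : Ω → C(Vec p, ℝ)) (hZ : IsRandomFunction Z)
    (uhat : Ω → Vec p)
    (hA1 : CondA1 P Θ 𝒯 H θs a)
    (hA2approx : CondA2Approx P Θ 𝒯 H θs a V)
    (hA2stable : CondA2Stable 𝒢 P V Z)
    (hA3 : CondA3 Θ θs a)
    (hA4 : CondA4 P (limitSet Θ θs a) Z uhat) :
    StablyConverges 𝒢 P (atTop : Filter 𝕋) (rescaled θhat θs a) uhat ∧
      ∀ (T₀ : 𝕋) (vhat : 𝕋 → Ω → Vec p), CondA5 P (limitSet Θ θs a) V T₀ vhat →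
        TendstoInMeasure P (fun T ω => rescaled θhat θs a T ω - vhat T ω) atTop
          (fun _ => (0 : Vec p)) := by
  obtain ⟨hu, -, huniq⟩ := hA4
  have hasym := isAsymptoticMaximizer_rescaled h𝕋 hθs hH hτhat hθhat hmax hA1 hA2approx hA3
  constructor
  · refine StablyConverges.of_one_le h𝒢 (measurable_rescaled hθhat) hu.1
      fun f W C hW h1 hC => ?_
    obtain ⟨Q, m, hQ, hm, hle, hint⟩ :=
      exists_isProbabilityMeasure_integral_mul_eq (P := P) (hW.mono h𝒢 le_rfl) h1 hC
    have hac : Q ≪ P := fun s hs => le_antisymm ((hle s).trans (by simp [hs])) zero_le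
    have := isCountablyGenerated_atTop_of_not_bddAbove h𝕋
    simp_rw [hint]
    refine (tendsto_integral_of_forall_eventually_measure_le (measurable_rescaled hθhat) hu.1
      (fun F hF ε hε => ?_) f).const_mul m
    have hconv : ∀ R : ℝ, 0 < R → ∀ g : C(Metric.closedBall (0 : Vec p) R, ℝ) →ᵇ ℝ,
        Tendsto (fun T => ∫ ω, g ((V T ω).restrict _) ∂Q) atTop
          (𝓝 (∫ ω, g ((Z ω).restrict _) ∂Q)) := by
      intro R hR g
      have h2 := hA2stable R hR g W hW ⟨C, fun ω => by
        rw [abs_of_nonneg] <;> linarith [h1 ω, hC ω]⟩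
      -- Dividing by `m` turns stable convergence tested against `W` into convergence in law under
      -- `Q`.
      have h3 := h2.const_mul m⁻¹
      simpa only [hint, inv_mul_cancel_left₀ hm.ne'] using h3
    have hasymQ := hasym.of_le_smul ENNReal.ofReal_ne_top hle
    -- On the diagonal, membership in `F ×ˢ F` is membership in `F`.
    have hpair := eventually_measure_pair_mem_le isClosed_limitSet hV hZ hu (hac.ae_le huniq)
      hconv hasymQ hasymQ (hF.prod hF) hε
    simp only [Set.mem_prod, and_self] at hpair
    exact hpair
  · intro T₀ vhat hA5
    rw [tendstoInMeasure_iff_norm]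
    intro ε hε
    have hconv : ∀ R : ℝ, 0 < R → ∀ g : C(Metric.closedBall (0 : Vec p) R, ℝ) →ᵇ ℝ,
        Tendsto (fun T => ∫ ω, g ((V T ω).restrict _) ∂P) atTop
          (𝓝 (∫ ω, g ((Z ω).restrict _) ∂P)) := by
      intro R hR g
      simpa using hA2stable R hR g (fun _ => 1) measurable_const ⟨1, by simp⟩
    have hF : IsClosed {z : Vec p × Vec p | ε ≤ ‖z.1 - z.2‖} :=
      isClosed_le (by fun_prop) (by fun_prop)
    refine ENNReal.tendsto_nhds_zero.2 fun η hη => ?_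
    have hpair := eventually_measure_pair_mem_le isClosed_limitSet hV hZ hu huniq
      hconv hasym hA5.isAsymptoticMaximizer hF hη
    -- The limit pair `(u₀, u₀)` has difference `0 < ε`, so its term vanishes.
    simpa [not_le.2 hε] using hpair
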